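/- **Setting.** There are $P\ge 1$ processors. Each processor owns some work (possibly none): a binary tree whose leaves are serial tasks of positive integer size. (The trees may be balanced in the number of tasks, but the bound does not need this.) $T_\infty$ denotes the span: the height of the larger binary tree obtained by connecting the $P$ roots by a binary tree of height $\lceil\lg P\rceil$, plus the size of the largest serial task, where $\lg=\log_2$. *Localized work stealing.* Initially every processor holds its own tree and keeps an empty list of names. In every time step, each processor that has work performs one unit of work on the first (leftmost) serial task of its tree, and each free processor makes one steal attempt, as long as some processor has work left. If the list of a free processor is nonempty, the attempt is a *steal-back*: the target is uniformly random among the processors on the list, and only work owned by the processor that steals back can be taken. Otherwise it is a *general steal*: the target is uniformly random among all processors that have work left. The choices of the processors in a time step are independent. A steal takes one of the two main branches of the target's tree, the one that the target is not working on; a single serial task cannot be stolen. If several processors try to steal from the same target in the same time step and it has something to take for them, an arbitrary one of them succeeds and the others fail; this decision may depend in any way on the steal attempts made so far, including those of the present time step. A processor that performs a general steal enters its name in the list of the owner of the stolen work, unless it is itself this owner. If a steal-back is unsuccessful because the target has none of the owner's work left that can be taken, the owner removes the target from its list. **Theorem.** There is a universal constant $C>0$ such that for all $P\ge1$, all works of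 the $P$ processors, all ways of deciding between contending processors, all $0<\epsilon\le 1$ and all $n$, with probability at least $1-\epsilon$ the number of steal attempts (general steals plus steal-backs, successful or not) in the first $n$ time steps of the localized work-stealing algorithm is at most $$C\,P^2\bigl(T_\infty+\lg(P/\epsilon)\bigr).$$ Since the execution ends after finitely many steps and no attempts are made afterwards, this bounds the total number of steal attempts. No assumption is made on how the free processors are distributed over the remaining owners' work. -/

import Mathlib

namespace LocalizedStealing

/-- The work of a processor: a binary tree whose leaves are serial tasks of positive integer size.
During an execution the size at a leaf is the number of time units that the task still needs. -/
inductive WorkTree where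
  | task (size : ℕ+) : WorkTree
  | branch (left right : WorkTree) : WorkTree

namespace WorkTree

/-- The height of the tree (number of edges on a longest path from the root to a leaf). -/
def height : WorkTree → ℕ
  | task _ => 0
  | branch l r => max l.height r.height + 1

/-- The size of the largest serial task in the tree. -/
def maxTask : WorkTree → ℕ
  | task s => (s : ℕ)
  | branch l r => max l.maxTask r.maxTask

/-- What is left after one unit of work. A processor always works inside the left branch of its
tree, hence on the leftmost serial task; a completed branch disappears. -/
def afterUnit : WorkTree → Option WorkTree
  | task s => if s = 1 then none else some (task (s - 1))
  | branch l r =>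
    match l.afterUnit with
    | none => some r
    | some l' => some (branch l' r)

/-- What the holder of the tree keeps when it is stolen from: the main branch it is working on. -/
def keep : WorkTree → WorkTree
  | task s => task s
  | branch l _ => l

/-- What can be stolen: the main branch that the holder is not working on. A single serial task
cannot be stolen. -/
def give : WorkTree → Option WorkTree
  | task _ => none
  | branch _ r => some r

end WorkTree

/-- A tree of unfinished work in the hands of some processor, with the processor that owns it. -/
structure Holding (P : ℕ) where
  owner : Fin P
  tree : WorkTree

/-- The situation at the beginning of a time step: the unfinished work held by each processor
(`none` if the processor is free), and, for each owner, the list of names of the other processors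
that are recorded as working on its work. -/
structure Config (P : ℕ) where
  held : Fin P → Option (Holding P)
  names : Fin P → Finset (Fin P)

/-- The steal attempts of one time step: the victim chosen by each processor, `none` if the
processor makes no steal attempt. -/
abbrev Requests (P : ℕ) := Fin P → Option (Fin P)

/-- Initially each processor holds exactly its own work and all lists are empty. -/
def initial {P : ℕ} (work : Fin P → Option WorkTree) : Config P where
  held i := (work i).map fun T => ⟨i, T⟩
  names _ := ∅

namespace Config

variable {P : ℕ}

/-- The processors that have work left to do. -/
def busy (c : Config P) : Finset (Fin P) :=
  Finset.univ.filter fun p => (c.held p).isSome = true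

/-- The equally likely choices of processor `p` in the present time step. A processor with work,
and any processor once all the work is done, makes no attempt. A free processor attempts a
steal-back from a processor on its list if the list is nonempty, and otherwise a general steal from
a processor that has work left. -/
def choices (c : Config P) (p : Fin P) : Finset (Option (Fin P)) :=
  if (c.held p).isSome = true ∨ c.busy = ∅ then {none}
  else if (c.names p).Nonempty then (c.names p).image some
  else c.busy.image some

theorem choices_nonempty (c : Config P) :
    (Fintype.piFinset fun p => c.choices p).Nonempty := by
  rw [Fintype.piFinset_nonempty]
  intro p
  unfold choices
  split_ifs with h1 h2
  · exact Finset.singleton_nonempty _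
  · exact h2.image _
  · exact (Finset.nonempty_iff_ne_empty.mpr fun h => h1 (Or.inr h)).image _

/-- The steal attempts of one time step: all processors choose independently and uniformly (the
uniform distribution on a product is the product of the uniform distributions). -/
noncomputable def requestLaw (c : Config P) : PMF (Requests P) :=
  PMF.uniformOfFinset (Fintype.piFinset fun p => c.choices p) c.choices_nonempty

/-- What processor `p` would obtain from `v` if nobody else tried to steal from `v`. A steal-back
(`p` has a nonempty list) only takes work that is owned by `p`. -/
def prize (c : Config P) (p v : Fin P) : Option (Holding P) :=
  match c.held v with
  | none => none
  | some H =>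
    if (c.names p).Nonempty ∧ H.owner ≠ p then none
    else H.tree.give.map fun T => ⟨H.owner, T⟩

/-- The processors that try to steal from `v` and for which `v` has something to take. -/
def contenders (c : Config P) (r : Requests P) (v : Fin P) : Finset (Fin P) :=
  Finset.univ.filter fun p => r p = some v ∧ (c.prize p v).isSome = true

/-- What processor `p` steals in this time step. If several processors contend for the same
victim `v`, then `pick v` of the set of contenders succeeds and the others fail. -/
def loot (c : Config P) (r : Requests P) (pick : Fin P → Finset (Fin P) → Fin P) (p : Fin P) :
    Option (Holding P) :=
  match r p with
  | none => none
  | some v =>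
    if p ∈ c.contenders r v ∧ pick v (c.contenders r v) = p then c.prize p v else none

/-- One time step. A processor with work loses the branch that is stolen from it, if any, and
performs one unit of work on the rest; a free processor receives what it steals. From the list of
`i`, a name is removed if `i` tried a steal-back from that processor and it had nothing to take back
(losing against another contender is no reason for removal); a processor that steals work of another
owner, which is necessarily a general steal, enters the list of this owner. -/
def step (c : Config P) (r : Requests P) (pick : Fin P → Finset (Fin P) → Fin P) : Config P where
  held p :=
    match c.held p with
    | none => c.loot r pick p
    | some H =>
      (if (c.contenders r p).Nonempty then H.tree.keep else H.tree).afterUnit.map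
        fun T => ⟨H.owner, T⟩
  names i :=
    ((c.names i).filter fun q => ¬ (r i = some q ∧ c.prize i q = none)) ∪
      Finset.univ.filter fun p => p ≠ i ∧ (c.loot r pick p).map Holding.owner = some i

end Config

/-- An arbitrary way to decide which one of several contenders for the same victim succeeds. The
decision may depend on everything that has happened so far, including all the attempts of the
present time step, which come first in the list. -/
structure TieBreak (P : ℕ) where
  pick : List (Requests P) → Fin P → Finset (Fin P) → Fin P
  pick_mem : ∀ (h : List (Requests P)) (v : Fin P) (s : Finset (Fin P)),
    s.Nonempty → pick h v s ∈ s

section Execution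

variable {P : ℕ}

/-- The configuration after a given history of steal attempts, the most recent time step first. -/
def configAfter (work : Fin P → Option WorkTree) (τ : TieBreak P) :
    List (Requests P) → Config P
  | [] => initial work
  | r :: h => (configAfter work τ h).step r (τ.pick (r :: h))

/-- The law of the history of steal attempts in the first `n` time steps of the localized
work-stealing algorithm. -/
noncomputable def historyLaw (work : Fin P → Option WorkTree) (τ : TieBreak P) :
    ℕ → PMF (List (Requests P))
  | 0 => PMF.pure []
  | n + 1 => (historyLaw work τ n).bind fun h =>
      (configAfter work τ h).requestLaw.map fun r => r :: h

/-- The number of steal attempts, general steals and steal-backs, successful or not, in a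
history. -/
def stealAttempts (h : List (Requests P)) : ℕ :=
  (h.map fun r => (Finset.univ.filter fun p => (r p).isSome = true).card).sum

/-- The span: the height of the binary tree that results when the roots of the trees of the `P`
processors are connected by a binary tree of height `⌈lg P⌉`, plus the size of the largest serial
task. -/
def span (work : Fin P → Option WorkTree) : ℕ :=
  (Nat.clog 2 P + Finset.univ.sup fun i => (work i).elim 0 WorkTree.height) +
    Finset.univ.sup fun i => (work i).elim 0 WorkTree.maxTask

end Execution

end LocalizedStealing

/-! Give a tree the potential `4 ^ height * 2 ^ maxTask`. Stealing a main branch leaves two trees of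
at most a quarter of the potential each, and a unit of work on a single task halves its potential.
So a holding loses half of its potential in every step in which it is either indivisible or
contended for, no matter who wins. A processor that chooses among at most `P` targets, including
every holder of divisible work of a set `S` of owners, therefore lowers the expected potential of
`S` by a factor `1 - 1 / (2 * P)` (`sum_potential_step_le`).

Fix a processor `i`. A general steal of `i` does this for all owners. A steal-back does it for `S =
{i}`, because every other holder of divisible work of `i` is on the list of `i` (`NamesComplete`).
Once the work of `i` is finished, its list cannot grow, and each steal-back deletes a name, so at
most `P` of them remain.

The product of `1 +` total potential, `1 +` potential of `i`, and a factor `staleWeight` for these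
last steal-backs thus compensates, in expectation, for a factor `rate P = 1 + 1 / (4 * P)` per
attempt of `i` (`NamesComplete.sum_weight_le`). Multiplied by `rate P ^ attempts i` and summed over
`i`, it is a supermartingale with initial value at most `8 * P ^ 3 * 16 ^ span`. More than `P * m`
attempts in all force some processor to make more than `m`, so Markov's inequality, with `m` of
order `P * (span + lg (P / ε))`, gives the bound. -/

namespace LocalizedStealing

/-! ### Potential of a single tree -/

namespace WorkTree

/-- The potential of a tree: it at least halves when a branch is stolen from the tree and when one
unit of work is performed on a single task. -/
noncomputable def potential (T : WorkTree) : ℝ := 4 ^ T.height * 2 ^ T.maxTask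

theorem one_le_potential (T : WorkTree) : 1 ≤ T.potential :=
  one_le_mul_of_one_le_of_one_le (one_le_pow₀ (by norm_num)) (one_le_pow₀ (by norm_num))

theorem potential_nonneg (T : WorkTree) : 0 ≤ T.potential :=
  zero_le_one.trans T.one_le_potential

theorem potential_le {T U : WorkTree} (hh : T.height ≤ U.height) (hm : T.maxTask ≤ U.maxTask) :
    T.potential ≤ U.potential := by
  unfold potential
  gcongr <;> norm_num

theorem potential_left (l r : WorkTree) : l.potential ≤ (branch l r).potential / 4 := by
  have h : (4 : ℝ) ^ l.height * 2 ^ l.maxTask ≤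
      4 ^ max l.height r.height * 2 ^ max l.maxTask r.maxTask := by
    gcongr <;> norm_num
  simp only [potential, height, maxTask, pow_succ]
  linarith

theorem potential_right (l r : WorkTree) : r.potential ≤ (branch l r).potential / 4 := by
  have h : (4 : ℝ) ^ r.height * 2 ^ r.maxTask ≤
      4 ^ max l.height r.height * 2 ^ max l.maxTask r.maxTask := by
    gcongr <;> norm_num
  simp only [potential, height, maxTask, pow_succ]
  linarith

theorem afterUnit_le {T U : WorkTree} (h : T.afterUnit = some U) :
    U.height ≤ T.height ∧ U.maxTask ≤ T.maxTask := by
  induction T generalizing U with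
  | task s =>
    simp only [afterUnit] at h
    split_ifs at h with hs
    obtain rfl := Option.some.inj h
    have : 1 < s := lt_of_le_of_ne one_le (Ne.symm hs)
    simp only [height, maxTask, PNat.sub_coe, this, if_true]
    exact ⟨le_rfl, Nat.sub_le _ _⟩
  | branch l r ihl _ =>
    simp only [afterUnit] at h
    split at h
    · obtain rfl := Option.some.inj h
      simp only [height, maxTask]
      omega
    · rename_i l' hl
      obtain rfl := Option.some.inj h
      obtain ⟨h1, h2⟩ := ihl hl
      simp only [height, maxTask]
      omega

theorem potential_afterUnit (T : WorkTree) : T.afterUnit.elim 0 potential ≤ T.potential := by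
  cases h : T.afterUnit with
  | none => exact T.potential_nonneg
  | some U => exact potential_le (afterUnit_le h).1 (afterUnit_le h).2

theorem potential_afterUnit_task (s : ℕ+) :
    (task s).afterUnit.elim 0 potential ≤ (task s).potential / 2 := by
  simp only [afterUnit]
  split_ifs with hs
  · have := potential_nonneg (task s)
    simp only [Option.elim]
    linarith
  · have h1 : 1 < s := lt_of_le_of_ne one_le (Ne.symm hs)
    have h2 : (s : ℕ) = ((s : ℕ) - 1) + 1 := by have := s.pos; omega
    simp only [Option.elim, potential, height, maxTask, PNat.sub_coe, h1, if_true]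
    rw [h2, pow_succ]
    simp

theorem give_isSome_of_afterUnit {T U : WorkTree} (h : T.afterUnit = some U)
    (hU : U.give.isSome = true) : T.give.isSome = true := by
  cases T with
  | task s =>
    simp only [afterUnit] at h
    split_ifs at h with hs
    obtain rfl := Option.some.inj h
    simp [give] at hU
  | branch l r => rfl

/-- The potential that a holding passes on to the next time step, when it is stolen from or not. -/
noncomputable def passedOn (T : WorkTree) (stolen : Prop) [Decidable stolen] : ℝ :=
  (if stolen then T.keep else T).afterUnit.elim 0 potential +
    if stolen then T.give.elim 0 potential else 0

/-- Base 4 for the height is what makes the two parts of a divided tree add up to a half; base 2 for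
the task size does the same for an indivisible tree, stolen from or not. -/
theorem passedOn_le_half (T : WorkTree) (stolen : Prop) [Decidable stolen]
    (h : T.give.isSome = true → stolen) : T.passedOn stolen ≤ T.potential / 2 := by
  unfold passedOn
  cases T with
  | task s => simpa [keep, give] using potential_afterUnit_task s
  | branch l r =>
    have hs : stolen := h rfl
    simp only [hs, if_true, keep, give, Option.elim_some]
    linarith [potential_afterUnit l, potential_left l r, potential_right l r]

theorem passedOn_le (T : WorkTree) (stolen : Prop) [Decidable stolen] :
    T.passedOn stolen ≤ T.potential := by
  by_cases h : stolen
  · have := T.passedOn_le_half stolen fun _ => h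
    linarith [T.potential_nonneg]
  · simpa [passedOn, h] using T.potential_afterUnit

end WorkTree

open WorkTree

/-! ### Potential of the work of a set of owners and its expected decrease -/

namespace Config

variable {P : ℕ}

/-- The potential of a holding, if its owner belongs to `S`. -/
noncomputable def holdingPotential (S : Finset (Fin P)) (H : Option (Holding P)) : ℝ :=
  H.elim 0 fun H => if H.owner ∈ S then H.tree.potential else 0

/-- The total potential of the unfinished work of the owners in `S`. -/
noncomputable def potential (c : Config P) (S : Finset (Fin P)) : ℝ :=
  ∑ p, holdingPotential S (c.held p)

theorem holdingPotential_nonneg (S : Finset (Fin P)) (H : Option (Holding P)) :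
    0 ≤ holdingPotential S H := by
  cases H with
  | none => exact le_rfl
  | some H =>
    simp only [holdingPotential, Option.elim_some]
    split_ifs
    exacts [H.tree.potential_nonneg, le_rfl]

theorem potential_nonneg (c : Config P) (S : Finset (Fin P)) : 0 ≤ c.potential S :=
  Finset.sum_nonneg fun _ _ => holdingPotential_nonneg _ _

theorem one_le_potential {c : Config P} {S : Finset (Fin P)} {p : Fin P} {H : Holding P}
    (hp : c.held p = some H) (hS : H.owner ∈ S) : 1 ≤ c.potential S := by
  refine le_trans ?_ (Finset.single_le_sum
    (f := fun p => holdingPotential S (c.held p))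
    (fun _ _ => holdingPotential_nonneg _ _) (Finset.mem_univ p))
  simpa [holdingPotential, hp, hS] using H.tree.one_le_potential

theorem one_le_potential_or (c : Config P) (S : Finset (Fin P)) :
    1 ≤ c.potential S ∨
      c.potential S = 0 ∧ ∀ p H, c.held p = some H → H.owner ∉ S := by
  by_cases h : ∃ p H, c.held p = some H ∧ H.owner ∈ S
  · obtain ⟨p, H, hp, hS⟩ := h
    exact Or.inl (one_le_potential hp hS)
  · push Not at h
    refine Or.inr ⟨Finset.sum_eq_zero fun p _ => ?_, h⟩
    cases hp : c.held p with
    | none => rfl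
    | some H => simp [holdingPotential, h p H hp]

/-- The potential that the work held by `v` passes on to the next time step. -/
noncomputable def passedOn (c : Config P) (r : Requests P) (S : Finset (Fin P)) (v : Fin P) : ℝ :=
  (c.held v).elim 0 fun H =>
    if H.owner ∈ S then H.tree.passedOn (c.contenders r v).Nonempty else 0

theorem prize_eq_some {c : Config P} {p v : Fin P} {H : Holding P} (h : c.prize p v = some H) :
    ∃ H', c.held v = some H' ∧ H'.owner = H.owner ∧ H'.tree.give = some H.tree ∧
      ((c.names p).Nonempty → H.owner = p) := by
  unfold prize at h
  cases hv : c.held v with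
  | none => simp [hv] at h
  | some H' =>
    simp only [hv] at h
    split_ifs at h with hn
    obtain ⟨T, hT, rfl⟩ := Option.map_eq_some_iff.mp h
    exact ⟨H', rfl, rfl, hT, fun hne => by_contra fun ho => hn ⟨hne, ho⟩⟩

theorem loot_eq_some {c : Config P} {r : Requests P}
    {pick : Fin P → Finset (Fin P) → Fin P} {p : Fin P} {H : Holding P}
    (h : c.loot r pick p = some H) :
    ∃ v, r p = some v ∧ p ∈ c.contenders r v ∧ pick v (c.contenders r v) = p ∧
      c.prize p v = some H := by
  unfold loot at h
  cases hr : r p with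
  | none => simp [hr] at h
  | some v =>
    simp only [hr] at h
    split_ifs at h with hc
    exact ⟨v, rfl, hc.1, hc.2, h⟩

/-- Every tree held after the step is the kept or the stolen part of a tree held before, and a
stolen part has only one recipient, the processor named by `pick`. The right-hand side does not
depend on `pick`, which is why ties may be broken adversarially. -/
theorem potential_step_le (c : Config P) (r : Requests P)
    (pick : Fin P → Finset (Fin P) → Fin P) (S : Finset (Fin P)) :
    (c.step r pick).potential S ≤ ∑ v, c.passedOn r S v := by
  classical
  let kept : Fin P → ℝ := fun v => (c.held v).elim 0 fun H => if H.owner ∈ S then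
    (if (c.contenders r v).Nonempty then H.tree.keep else H.tree).afterUnit.elim 0
      WorkTree.potential else 0
  let given : Fin P → ℝ := fun v => (c.held v).elim 0 fun H => if H.owner ∈ S then
    (if (c.contenders r v).Nonempty then H.tree.give.elim 0 WorkTree.potential else 0) else 0
  have given_nonneg : ∀ v, 0 ≤ given v := by
    intro v
    simp only [given]
    cases c.held v with
    | none => exact le_rfl
    | some H =>
      simp only [Option.elim_some]
      split_ifs
      · cases H.tree.give with
        | none => exact le_rfl
        | some T => exact T.potential_nonneg
      · exact le_rfl
      · exact le_rfl
  have hsplit : ∀ v, c.passedOn r S v = kept v + given v := by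
    intro v
    simp only [Config.passedOn, kept, given, WorkTree.passedOn]
    cases c.held v with
    | none => simp
    | some H =>
      simp only [Option.elim_some]
      by_cases hS : H.owner ∈ S <;> simp [hS]
  have hp : ∀ p, holdingPotential S ((c.step r pick).held p) ≤
      kept p + ∑ v, if pick v (c.contenders r v) = p then given v else 0 := by
    intro p
    have hsum : ∀ p, 0 ≤ ∑ v, if pick v (c.contenders r v) = p then given v else 0 := fun p =>
      Finset.sum_nonneg fun v _ => by
        split_ifs
        exacts [given_nonneg v, le_rfl]
    cases hh : c.held p with
    | some H =>
      have : holdingPotential S ((c.step r pick).held p) = kept p := by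
        simp only [step, hh, kept, holdingPotential, Option.elim_some]
        cases (if (c.contenders r p).Nonempty then H.tree.keep else H.tree).afterUnit <;> simp
      rw [this]
      linarith [hsum p]
    | none =>
      have hk : kept p = 0 := by simp [kept, hh]
      have hs : (c.step r pick).held p = c.loot r pick p := by simp [step, hh]
      rw [hk, zero_add, hs]
      cases hl : c.loot r pick p with
      | none => exact hsum p
      | some H =>
        obtain ⟨v, _, hc, hpick, hprize⟩ := loot_eq_some hl
        obtain ⟨H', hv, ho, hg, _⟩ := prize_eq_some hprize
        refine le_trans ?_ (Finset.single_le_sum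
          (f := fun v => if pick v (c.contenders r v) = p then given v else 0)
          (fun v _ => ?_) (Finset.mem_univ v))
        · have hne : (c.contenders r v).Nonempty := ⟨p, hc⟩
          simp [hpick, given, hv, ho, hne, hg, holdingPotential]
        · split_ifs
          exacts [given_nonneg v, le_rfl]
  calc (c.step r pick).potential S
      ≤ ∑ p, (kept p + ∑ v, if pick v (c.contenders r v) = p then given v else 0) :=
        Finset.sum_le_sum fun p _ => hp p
    _ = ∑ v, c.passedOn r S v := by
        rw [Finset.sum_add_distrib, Finset.sum_comm]
        simp [hsplit, Finset.sum_add_distrib]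

theorem passedOn_le (c : Config P) (r : Requests P) (S : Finset (Fin P)) (v : Fin P) :
    c.passedOn r S v ≤ holdingPotential S (c.held v) := by
  unfold passedOn holdingPotential
  cases c.held v with
  | none => exact le_rfl
  | some H =>
    simp only [Option.elim_some]
    split_ifs
    exacts [H.tree.passedOn_le _, le_rfl]

theorem potential_step_le_potential (c : Config P) (r : Requests P)
    (pick : Fin P → Finset (Fin P) → Fin P) (S : Finset (Fin P)) :
    (c.step r pick).potential S ≤ c.potential S :=
  (c.potential_step_le r pick S).trans (Finset.sum_le_sum fun v _ => c.passedOn_le r S v)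

/-- The request of `i` makes the set of contenders nonempty, which suffices even if `i` loses.
Indivisible work halves by itself, so the hypothesis concerns divisible work only. -/
theorem passedOn_le_of_request {c : Config P} {i v : Fin P} (r : Requests P) (S : Finset (Fin P))
    (h : ∀ H, c.held v = some H → H.owner ∈ S → H.tree.give.isSome = true →
      r i = some v ∧ (c.prize i v).isSome = true) :
    c.passedOn r S v ≤ holdingPotential S (c.held v) / 2 := by
  unfold passedOn holdingPotential
  cases hv : c.held v with
  | none => simp
  | some H =>
    simp only [Option.elim_some]
    split_ifs with hS
    · refine H.tree.passedOn_le_half _ fun hg => ⟨i, ?_⟩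
      simpa [contenders] using h H hv hS hg
    · simp

/-- This is the marginal law of the choice of `i`, stated by counting in the product of the sets of
choices. -/
theorem card_filter_request {c : Config P} {i : Fin P} {a : Option (Fin P)}
    (ha : a ∈ c.choices i) :
    ((((Fintype.piFinset fun p => c.choices p).filter fun r => r i = a).card : ℕ) : ℝ) *
      (c.choices i).card = (Fintype.piFinset fun p => c.choices p).card := by
  classical
  rw [Fintype.card_filter_piFinset_eq_of_mem _ _ ha, Fintype.card_piFinset,
    ← Finset.prod_erase_mul _ _ (Finset.mem_univ i)]
  push_cast
  rfl

theorem card_choices_le (c : Config P) (i : Fin P) (hP : 0 < P) : (c.choices i).card ≤ P := by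
  unfold choices
  split_ifs
  · simpa using Nat.one_le_iff_ne_zero.mpr hP.ne'
  · exact Finset.card_image_le.trans ((Finset.card_le_univ _).trans (by simp))
  · exact Finset.card_image_le.trans ((Finset.card_le_univ _).trans (by simp))

/-- If processor `i` can choose every processor that holds divisible work of an owner in `S`, and
would then have something to take, then the expected potential of these owners drops. -/
theorem sum_potential_step_le (c : Config P) (pick : Requests P → Fin P → Finset (Fin P) → Fin P)
    (S : Finset (Fin P)) (i : Fin P)
    (h : ∀ v H, c.held v = some H → H.owner ∈ S → H.tree.give.isSome = true →
      some v ∈ c.choices i ∧ (c.prize i v).isSome = true) :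
    ∑ r ∈ Fintype.piFinset (fun p => c.choices p), (c.step r (pick r)).potential S ≤
      (Fintype.piFinset fun p => c.choices p).card *
        ((1 - 1 / (2 * (P : ℝ))) * c.potential S) := by
  classical
  set R := Fintype.piFinset fun p => c.choices p with hR
  have hP : 0 < P := i.pos
  have hP' : (1 : ℝ) ≤ P := by exact_mod_cast hP
  have hv : ∀ v, ∑ r ∈ R, c.passedOn r S v ≤
      R.card * ((1 - 1 / (2 * (P : ℝ))) * holdingPotential S (c.held v)) := by
    intro v
    set φ := holdingPotential S (c.held v) with hφ
    have hφ0 : 0 ≤ φ := holdingPotential_nonneg _ _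
    -- Divisible work halves at least when `i` chooses `v`, which has probability at least `1 / P`;
    -- all other work relevant to `S` halves with certainty.
    by_cases hd : ∃ H, c.held v = some H ∧ H.owner ∈ S ∧ H.tree.give.isSome = true
    · obtain ⟨H, hH, hS, hg⟩ := hd
      obtain ⟨hmem, hprize⟩ := h v H hH hS hg
      have hcard := card_filter_request hmem
      rw [← hR] at hcard
      have hle : ((c.choices i).card : ℝ) ≤ P := by exact_mod_cast c.card_choices_le i hP
      calc ∑ r ∈ R, c.passedOn r S v
          ≤ ∑ r ∈ R, (φ - if r i = some v then φ / 2 else 0) := by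
            refine Finset.sum_le_sum fun r _ => ?_
            split_ifs with hr
            · have := passedOn_le_of_request (c := c) (i := i) (v := v) r S
                fun _ _ _ _ => ⟨hr, hprize⟩
              linarith
            · simpa using c.passedOn_le r S v
        _ = R.card * φ - (R.filter fun r => r i = some v).card * (φ / 2) := by
            rw [Finset.sum_sub_distrib, ← Finset.sum_filter]
            simp
        _ ≤ R.card * ((1 - 1 / (2 * (P : ℝ))) * φ) := by
            have h1 : (R.card : ℝ) / P ≤ (R.filter fun r => r i = some v).card := by
              rw [div_le_iff₀ (by linarith), ← hcard]
              gcongr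
            have h2 : (R.card : ℝ) / P * (φ / 2) ≤
                (R.filter fun r => r i = some v).card * (φ / 2) := by gcongr
            have h3 : R.card * ((1 - 1 / (2 * (P : ℝ))) * φ) =
                R.card * φ - (R.card : ℝ) / P * (φ / 2) := by
              field_simp
            linarith
    · have h1 : 1 / (2 * (P : ℝ)) ≤ 1 / 2 := by
        apply one_div_le_one_div_of_le <;> linarith
      calc ∑ r ∈ R, c.passedOn r S v ≤ ∑ r ∈ R, φ / 2 :=
            Finset.sum_le_sum fun r _ => passedOn_le_of_request (i := i) r S
              fun H hH hS hg => (hd ⟨H, hH, hS, hg⟩).elim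
        _ = R.card * (φ / 2) := by simp
        _ ≤ _ := by
            gcongr
            nlinarith
  calc ∑ r ∈ R, (c.step r (pick r)).potential S
      ≤ ∑ r ∈ R, ∑ v, c.passedOn r S v :=
        Finset.sum_le_sum fun r _ => c.potential_step_le r (pick r) S
    _ = ∑ v, ∑ r ∈ R, c.passedOn r S v := Finset.sum_comm
    _ ≤ ∑ v, R.card * ((1 - 1 / (2 * (P : ℝ))) * holdingPotential S (c.held v)) :=
        Finset.sum_le_sum fun v _ => hv v
    _ = _ := by rw [potential, Finset.mul_sum, Finset.mul_sum]

/-! ### Completeness of the lists of names -/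

/-- The lists of names are complete, except possibly for processors with a single task. -/
def NamesComplete (c : Config P) : Prop :=
  ∀ q H, c.held q = some H → q ≠ H.owner → H.tree.give.isSome = true → q ∈ c.names H.owner

/-- A thief of foreign work is entered at once. A name is deleted only when nothing of the owner's
can be taken there, and a held tree that is indivisible stays so until its holder steals again. -/
theorem NamesComplete.step {c : Config P} (hc : c.NamesComplete) (r : Requests P)
    (pick : Fin P → Finset (Fin P) → Fin P) : (c.step r pick).NamesComplete := by
  intro q H hq hne hg
  simp only [Config.step] at hq ⊢
  rw [Finset.mem_union, Finset.mem_filter, Finset.mem_filter]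
  cases hh : c.held q with
  | none =>
    simp only [hh] at hq
    exact Or.inr ⟨Finset.mem_univ _, hne, by simp [hq]⟩
  | some K =>
    simp only [hh] at hq
    obtain ⟨T, hT, rfl⟩ := Option.map_eq_some_iff.mp hq
    have hK : K.tree.give.isSome = true := by
      have h1 := give_isSome_of_afterUnit hT hg
      split_ifs at h1
      · cases hK : K.tree with
        | task s => simp [hK, keep, give] at h1
        | branch l r => rfl
      · exact h1
    have hmem := hc q K hh hne hK
    refine Or.inl ⟨hmem, fun hr => ?_⟩
    have := hr.2
    simp only [prize, hh, ne_eq, not_true_eq_false, and_false, if_false,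
      Option.map_eq_none_iff] at this
    simp [this] at hK

end Config

theorem namesComplete_configAfter {P : ℕ} (work : Fin P → Option WorkTree) (τ : TieBreak P)
    (h : List (Requests P)) : (configAfter work τ h).NamesComplete := by
  induction h with
  | nil =>
    intro q H hq hne _
    obtain ⟨T, _, rfl⟩ := Option.map_eq_some_iff.mp hq
    exact (hne rfl).elim
  | cons r h ih => exact ih.step _ _

/-! ### The weight of a configuration from the viewpoint of one processor -/

namespace Config

variable {P : ℕ}

/-- The factor by which the weight of a history grows with a steal attempt of a given processor. -/
noncomputable def rate (P : ℕ) : ℝ := 1 + 1 / (4 * (P : ℝ))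

theorem one_le_rate (P : ℕ) : 1 ≤ rate P := by
  unfold rate
  have : (0 : ℝ) ≤ 1 / (4 * (P : ℝ)) := by positivity
  linarith

theorem rate_pos (P : ℕ) : 0 < rate P := zero_lt_one.trans_le (one_le_rate P)

/-- Keeps the initial cost of `staleWeight` down to a constant factor. -/
theorem rate_pow_le_two {P : ℕ} (hP : 0 < P) : rate P ^ P ≤ 2 := by
  have hP' : (0 : ℝ) < P := by exact_mod_cast hP
  have h1 : rate P ≤ Real.exp (1 / (4 * (P : ℝ))) := by
    unfold rate
    linarith [Real.add_one_le_exp (1 / (4 * (P : ℝ)))]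
  calc rate P ^ P ≤ Real.exp (1 / (4 * (P : ℝ))) ^ P :=
        pow_le_pow_left₀ (rate_pos P).le h1 P
    _ = Real.exp (1 / 4) := by
        rw [← Real.exp_nat_mul]
        congr 1
        field_simp
    _ ≤ Real.exp (Real.log 2) := by
        apply Real.exp_le_exp.mpr
        linarith [Real.log_two_gt_d9]
    _ = 2 := Real.exp_log (by norm_num)

theorem two_le_rate_pow {P : ℕ} (hP : 0 < P) : 2 ≤ rate P ^ (4 * P) := by
  have hP' : (0 : ℝ) < P := by exact_mod_cast hP
  have h := one_add_mul_le_pow (a := 1 / (4 * (P : ℝ)))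
    (by have : (0 : ℝ) ≤ 1 / (4 * (P : ℝ)) := by positivity
        linarith) (4 * P)
  have h1 : ((4 * P : ℕ) : ℝ) * (1 / (4 * (P : ℝ))) = 1 := by
    push_cast
    field_simp
  unfold rate
  linarith

/-- This pays for the steal-backs that remain when all the work of `i` is done. -/
noncomputable def staleWeight (c : Config P) (i : Fin P) : ℝ :=
  if c.potential {i} = 0 then rate P ^ (c.names i).card else rate P ^ P

/-- The weight of a configuration, as seen by processor `i`: it at least compensates in expectation
for the factor `rate P` when `i` attempts to steal. -/
noncomputable def weight (c : Config P) (i : Fin P) : ℝ :=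
  (1 + c.potential Finset.univ) * (1 + c.potential {i}) * c.staleWeight i

theorem one_le_staleWeight (c : Config P) (i : Fin P) : 1 ≤ c.staleWeight i := by
  unfold staleWeight
  split_ifs <;> exact one_le_pow₀ (one_le_rate P)

theorem staleWeight_le (c : Config P) (i : Fin P) : c.staleWeight i ≤ rate P ^ P := by
  unfold staleWeight
  split_ifs
  · exact pow_le_pow_right₀ (one_le_rate P) ((Finset.card_le_univ _).trans (by simp))
  · exact le_rfl

theorem one_le_weight (c : Config P) (i : Fin P) : 1 ≤ c.weight i :=
  one_le_mul_of_one_le_of_one_le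
    (one_le_mul_of_one_le_of_one_le (by linarith [c.potential_nonneg Finset.univ])
      (by linarith [c.potential_nonneg {i}]))
    (c.one_le_staleWeight i)

theorem potential_step_eq_zero {c : Config P} {S : Finset (Fin P)} (h0 : c.potential S = 0)
    (r : Requests P) (pick : Fin P → Finset (Fin P) → Fin P) :
    (c.step r pick).potential S = 0 :=
  le_antisymm (h0 ▸ c.potential_step_le_potential r pick S) (potential_nonneg _ _)

theorem owner_ne_of_potential_eq_zero {c : Config P} {i : Fin P} (h0 : c.potential {i} = 0)
    {p : Fin P} {H : Holding P} (hp : c.held p = some H) : H.owner ≠ i := by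
  intro ho
  have := one_le_potential (S := {i}) hp (by simpa using ho)
  linarith

/-- A name is added only by a theft of work of `i`, and none is left. -/
theorem names_step_eq {c : Config P} {i : Fin P} (h0 : c.potential {i} = 0) (r : Requests P)
    (pick : Fin P → Finset (Fin P) → Fin P) :
    (c.step r pick).names i =
      (c.names i).filter fun q => ¬ (r i = some q ∧ c.prize i q = none) := by
  simp only [step]
  rw [Finset.union_eq_left]
  intro p hp
  obtain ⟨_, _, hl⟩ := Finset.mem_filter.mp hp
  obtain ⟨H, hH, ho⟩ := Option.map_eq_some_iff.mp hl
  obtain ⟨v, _, _, _, hprize⟩ := loot_eq_some hH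
  obtain ⟨H', hv, ho', _, _⟩ := prize_eq_some hprize
  exact (owner_ne_of_potential_eq_zero h0 hv (ho'.trans ho)).elim

theorem staleWeight_step_le (c : Config P) (i : Fin P) (r : Requests P)
    (pick : Fin P → Finset (Fin P) → Fin P) :
    (c.step r pick).staleWeight i ≤ c.staleWeight i := by
  by_cases h0 : c.potential {i} = 0
  · rw [staleWeight, staleWeight, if_pos h0, if_pos (potential_step_eq_zero h0 r pick),
      names_step_eq h0]
    exact pow_le_pow_right₀ (one_le_rate P) (Finset.card_filter_le _ _)
  · have h : c.staleWeight i = rate P ^ P := if_neg h0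
    exact h ▸ staleWeight_le _ _

/-- With no work of `i` left, its steal-back finds nothing to take, so `q` is deleted and the
exponent drops by at least one. -/
theorem rate_mul_staleWeight_step_le {c : Config P} {i q : Fin P} (h0 : c.potential {i} = 0)
    {r : Requests P} (hr : r i = some q) (hq : q ∈ c.names i)
    (pick : Fin P → Finset (Fin P) → Fin P) :
    rate P * (c.step r pick).staleWeight i ≤ c.staleWeight i := by
  rw [staleWeight, staleWeight, if_pos h0, if_pos (potential_step_eq_zero h0 r pick),
    names_step_eq h0, ← pow_succ']
  refine pow_le_pow_right₀ (one_le_rate P) (Finset.card_lt_card ?_)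
  refine Finset.filter_ssubset.mpr ⟨q, hq, fun h => h ⟨hr, ?_⟩⟩
  by_contra hne
  obtain ⟨H, hH⟩ := Option.ne_none_iff_exists'.mp hne
  obtain ⟨H', hv, ho, _, hi⟩ := prize_eq_some hH
  exact owner_ne_of_potential_eq_zero h0 hv (ho.trans (hi ⟨q, hq⟩))

/-- The summand `1` keeps the weight at least 1 when the potential vanishes. It does not shrink, but
since the potential is at least 1, half of the decrease of the potential pays for it. -/
theorem sum_rate_mul_le (c : Config P) (pick : Requests P → Fin P → Finset (Fin P) → Fin P)
    (S : Finset (Fin P)) (i : Fin P) (hS : 1 ≤ c.potential S)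
    (h : ∀ v H, c.held v = some H → H.owner ∈ S → H.tree.give.isSome = true →
      some v ∈ c.choices i ∧ (c.prize i v).isSome = true) :
    ∑ r ∈ Fintype.piFinset (fun p => c.choices p),
        rate P * (1 + (c.step r (pick r)).potential S) ≤
      (Fintype.piFinset fun p => c.choices p).card * (1 + c.potential S) := by
  have hd := c.sum_potential_step_le pick S i h
  set R := Fintype.piFinset fun p => c.choices p
  have hP' : (0 : ℝ) < P := by exact_mod_cast i.pos
  rw [← Finset.mul_sum, Finset.sum_add_distrib]
  have hx : (0 : ℝ) ≤ 1 / (4 * (P : ℝ)) := by positivity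
  have h2 : 1 / (2 * (P : ℝ)) = 2 * (1 / (4 * (P : ℝ))) := by field_simp; norm_num
  rw [h2] at hd
  unfold rate
  set x := 1 / (4 * (P : ℝ))
  set φ := c.potential S
  -- After expansion this reads `x ≤ φ * (x + 2 * x ^ 2)`, which follows from `1 ≤ φ`.
  have h3 : (1 + x) * (1 + (1 - 2 * x) * φ) ≤ 1 + φ := by nlinarith [mul_nonneg hx hx]
  calc (1 + x) * (∑ _r ∈ R, (1 : ℝ) + ∑ r ∈ R, (c.step r (pick r)).potential S)
      ≤ (1 + x) * (R.card + R.card * ((1 - 2 * x) * φ)) := by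
        gcongr
        simp
    _ = R.card * ((1 + x) * (1 + (1 - 2 * x) * φ)) := by ring
    _ ≤ _ := by gcongr

/-- None of the three factors ever increases, so for each kind of attempt it is enough that one of
them absorbs `rate P`: the potential of `i` for steal-backs while work of `i` is left, `staleWeight`
for later ones, the total potential for general steals. -/
theorem NamesComplete.sum_weight_le {c : Config P} (hc : c.NamesComplete)
    (pick : Requests P → Fin P → Finset (Fin P) → Fin P) (i : Fin P) :
    ∑ r ∈ Fintype.piFinset (fun p => c.choices p),
        (if (r i).isSome = true then rate P else 1) * (c.step r (pick r)).weight i ≤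
      (Fintype.piFinset fun p => c.choices p).card * c.weight i := by
  set R := Fintype.piFinset fun p => c.choices p with hR
  have hmem : ∀ r ∈ R, r i ∈ c.choices i := fun r hr => Fintype.mem_piFinset.mp hr i
  have hA : ∀ r, 1 + (c.step r (pick r)).potential Finset.univ ≤ 1 + c.potential Finset.univ :=
    fun r => by linarith [c.potential_step_le_potential r (pick r) Finset.univ]
  have hB : ∀ r, 1 + (c.step r (pick r)).potential {i} ≤ 1 + c.potential {i} :=
    fun r => by linarith [c.potential_step_le_potential r (pick r) {i}]
  have hD : ∀ r, (c.step r (pick r)).staleWeight i ≤ c.staleWeight i :=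
    fun r => c.staleWeight_step_le i r (pick r)
  have hA0 : ∀ (c : Config P), 0 ≤ 1 + c.potential Finset.univ :=
    fun c => by linarith [c.potential_nonneg Finset.univ]
  have hB0 : ∀ (c : Config P), 0 ≤ 1 + c.potential {i} :=
    fun c => by linarith [c.potential_nonneg {i}]
  have hD0 : ∀ (c : Config P), 0 ≤ c.staleWeight i :=
    fun c => zero_le_one.trans (c.one_le_staleWeight i)
  have hrate : ∀ r : Requests P, (if (r i).isSome = true then rate P else 1) ≤ rate P :=
    fun r => by
      split_ifs
      exacts [le_rfl, one_le_rate P]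
  have hW0 : ∀ (c : Config P), 0 ≤ c.weight i := fun c => zero_le_one.trans (c.one_le_weight i)
  by_cases hn : (c.held i).isSome = true ∨ c.busy = ∅
  · have hch : c.choices i = {none} := if_pos hn
    rw [← nsmul_eq_mul]
    refine Finset.sum_le_card_nsmul _ _ _ fun r hr => ?_
    have hri := hmem r hr
    rw [hch, Finset.mem_singleton] at hri
    simp only [hri, Option.isSome_none, Bool.false_eq_true, if_false, one_mul]
    exact mul_le_mul (mul_le_mul (hA r) (hB r) (hB0 _) (hA0 _)) (hD r) (hD0 _)
      (mul_nonneg (hA0 _) (hB0 _))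
  have hi : ∀ v H, c.held v = some H → v ≠ i := by
    rintro v H hv rfl
    exact hn (Or.inl (by simp [hv]))
  by_cases hne : (c.names i).Nonempty
  · have hch : c.choices i = (c.names i).image some := by
      rw [choices, if_neg hn, if_pos hne]
    -- Steal-back: either work of `i` remains, and the list contains all divisible parts of it, or
    -- the list is stale and loses a name.
    rcases c.one_le_potential_or {i} with h1 | ⟨h0, _⟩
    · have hsum := c.sum_rate_mul_le pick {i} i h1 fun v H hv hS hg => by
        have ho : H.owner = i := by simpa using hS
        have hvn : v ∈ c.names i := ho ▸ hc v H hv (ho ▸ hi v H hv) hg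
        refine ⟨by rw [hch]; exact Finset.mem_image_of_mem _ hvn, ?_⟩
        simp [prize, hv, ho, hg]
      calc _ ≤ ∑ r ∈ R, (1 + c.potential Finset.univ) * c.staleWeight i *
            (rate P * (1 + (c.step r (pick r)).potential {i})) := by
            refine Finset.sum_le_sum fun r _ => ?_
            calc _ ≤ rate P * (c.step r (pick r)).weight i :=
                  mul_le_mul_of_nonneg_right (hrate r) (hW0 _)
              _ ≤ rate P * ((1 + c.potential Finset.univ) *
                    (1 + (c.step r (pick r)).potential {i}) * c.staleWeight i) :=
                  mul_le_mul_of_nonneg_left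
                    (mul_le_mul (mul_le_mul_of_nonneg_right (hA r) (hB0 _)) (hD r) (hD0 _)
                      (mul_nonneg (hA0 _) (hB0 _))) (rate_pos P).le
              _ = _ := by ring
        _ ≤ (1 + c.potential Finset.univ) * c.staleWeight i *
              (R.card * (1 + c.potential {i})) := by
            rw [← Finset.mul_sum]
            exact mul_le_mul_of_nonneg_left hsum (mul_nonneg (hA0 _) (hD0 _))
        _ = _ := by
            rw [weight]
            ring
    · rw [← nsmul_eq_mul]
      refine Finset.sum_le_card_nsmul _ _ _ fun r hr => ?_
      have hri := hmem r hr
      rw [hch, Finset.mem_image] at hri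
      obtain ⟨q, hq, hri⟩ := hri
      have hs := rate_mul_staleWeight_step_le h0 hri.symm hq (pick r)
      calc _ ≤ rate P * (c.step r (pick r)).weight i :=
            mul_le_mul_of_nonneg_right (hrate r) (hW0 _)
        _ = (1 + (c.step r (pick r)).potential Finset.univ) *
              (1 + (c.step r (pick r)).potential {i}) *
              (rate P * (c.step r (pick r)).staleWeight i) := by
            rw [weight]
            ring
        _ ≤ _ := mul_le_mul (mul_le_mul (hA r) (hB r) (hB0 _) (hA0 _)) hs
            (mul_nonneg (rate_pos P).le (hD0 _)) (mul_nonneg (hA0 _) (hB0 _))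
  -- General steal: the list of `i` is empty, so `prize` does not restrict the owner.
  · have hch : c.choices i = c.busy.image some := by
      rw [choices, if_neg hn, if_neg hne]
    have h1 : 1 ≤ c.potential Finset.univ := by
      obtain ⟨p, hp⟩ := Finset.nonempty_iff_ne_empty.mpr fun h => hn (Or.inr h)
      obtain ⟨H, hH⟩ := Option.isSome_iff_exists.mp (Finset.mem_filter.mp hp).2
      exact one_le_potential hH (Finset.mem_univ _)
    have hsum := c.sum_rate_mul_le pick Finset.univ i h1 fun v H hv _ hg => by
      refine ⟨by rw [hch]; exact Finset.mem_image_of_mem _ (by simp [busy, hv]), ?_⟩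
      simp [prize, hv, hne, hg]
    calc _ ≤ ∑ r ∈ R, (1 + c.potential {i}) * c.staleWeight i *
          (rate P * (1 + (c.step r (pick r)).potential Finset.univ)) := by
          refine Finset.sum_le_sum fun r _ => ?_
          calc _ ≤ rate P * (c.step r (pick r)).weight i :=
                mul_le_mul_of_nonneg_right (hrate r) (hW0 _)
            _ ≤ rate P * ((1 + (c.step r (pick r)).potential Finset.univ) *
                  (1 + c.potential {i}) * c.staleWeight i) :=
                mul_le_mul_of_nonneg_left
                  (mul_le_mul (mul_le_mul_of_nonneg_left (hB r) (hA0 _)) (hD r) (hD0 _)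
                    (mul_nonneg (hA0 _) (hB0 _))) (rate_pos P).le
            _ = _ := by ring
      _ ≤ (1 + c.potential {i}) * c.staleWeight i *
            (R.card * (1 + c.potential Finset.univ)) := by
          rw [← Finset.mul_sum]
          exact mul_le_mul_of_nonneg_left hsum (mul_nonneg (hB0 _) (hD0 _))
      _ = _ := by
          rw [weight]
          ring

end Config

/-! ### The supermartingale and the tail bound -/

section Execution

open Config

variable {P : ℕ} (work : Fin P → Option WorkTree) (τ : TieBreak P)

/-- The number of steal attempts of processor `i` in a history. -/
def attempts (i : Fin P) (h : List (Requests P)) : ℕ := h.countP fun r => (r i).isSome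

theorem stealAttempts_eq_sum (h : List (Requests P)) :
    stealAttempts h = ∑ i, attempts i h := by
  induction h with
  | nil => simp [stealAttempts, attempts]
  | cons r h ih =>
    have : stealAttempts (r :: h) =
        (Finset.univ.filter fun p => (r p).isSome = true).card + stealAttempts h := by
      simp [stealAttempts]
    rw [this, ih, Finset.card_filter, ← Finset.sum_add_distrib]
    refine Finset.sum_congr rfl fun i _ => ?_
    rw [attempts, attempts, List.countP_cons, add_comm]

/-- The weight of a history, which is a supermartingale. -/
noncomputable def historyWeight (h : List (Requests P)) : ℝ :=
  ∑ i, rate P ^ attempts i h * (configAfter work τ h).weight i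

theorem historyWeight_nonneg (h : List (Requests P)) : 0 ≤ historyWeight work τ h :=
  Finset.sum_nonneg fun _ _ =>
    mul_nonneg (pow_nonneg (rate_pos P).le _) (zero_le_one.trans (one_le_weight _ _))

theorem sum_historyWeight_cons_le (h : List (Requests P)) :
    ∑ r ∈ Fintype.piFinset (fun p => (configAfter work τ h).choices p),
        historyWeight work τ (r :: h) ≤
      (Fintype.piFinset fun p => (configAfter work τ h).choices p).card *
        historyWeight work τ h := by
  simp only [historyWeight]
  rw [Finset.sum_comm, Finset.mul_sum]
  refine Finset.sum_le_sum fun i _ => ?_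
  have hstep := (namesComplete_configAfter work τ h).sum_weight_le (fun r => τ.pick (r :: h)) i
  have hpos : 0 ≤ rate P ^ attempts i h := pow_nonneg (rate_pos P).le _
  calc _ = rate P ^ attempts i h *
        ∑ r ∈ Fintype.piFinset (fun p => (configAfter work τ h).choices p),
          (if (r i).isSome = true then rate P else 1) *
            ((configAfter work τ h).step r (τ.pick (r :: h))).weight i := by
        rw [Finset.mul_sum]
        refine Finset.sum_congr rfl fun r _ => ?_
        rw [attempts, List.countP_cons, configAfter]
        split_ifs
        · rw [pow_succ, mul_assoc]
          rfl
        · rw [add_zero, one_mul]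
          rfl
    _ ≤ _ := mul_le_mul_of_nonneg_left hstep hpos
    _ = _ := by ring

theorem tsum_requestLaw_le (h : List (Requests P)) :
    ∑' r, (configAfter work τ h).requestLaw r * ENNReal.ofReal (historyWeight work τ (r :: h)) ≤
      ENNReal.ofReal (historyWeight work τ h) := by
  classical
  have hne := (configAfter work τ h).choices_nonempty
  have hsum := sum_historyWeight_cons_le work τ h
  simp only [requestLaw]
  set R := Fintype.piFinset fun p => (configAfter work τ h).choices p
  have hc0 : (R.card : ENNReal) ≠ 0 := by simpa using hne.ne_empty
  calc _ = ∑ r ∈ R, (R.card : ENNReal)⁻¹ * ENNReal.ofReal (historyWeight work τ (r :: h)) := by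
        rw [tsum_eq_sum (s := R)]
        · refine Finset.sum_congr rfl fun r hr => ?_
          rw [PMF.uniformOfFinset_apply_of_mem _ hr]
        · intro r hr
          rw [PMF.uniformOfFinset_apply_of_notMem _ hr, zero_mul]
    _ = (R.card : ENNReal)⁻¹ * ENNReal.ofReal (∑ r ∈ R, historyWeight work τ (r :: h)) := by
        rw [← Finset.mul_sum,
          ENNReal.ofReal_sum_of_nonneg fun r _ => historyWeight_nonneg work τ _]
    _ ≤ (R.card : ENNReal)⁻¹ * ENNReal.ofReal (R.card * historyWeight work τ h) := by
        gcongr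
    _ = _ := by
        rw [ENNReal.ofReal_mul (Nat.cast_nonneg _), ENNReal.ofReal_natCast, ← mul_assoc,
          ENNReal.inv_mul_cancel hc0 (ENNReal.natCast_ne_top _), one_mul]

theorem tsum_bind_mul {α β : Type*} (p : PMF α) (f : α → PMF β) (g : β → ENNReal) :
    ∑' b, p.bind f b * g b = ∑' a, p a * ∑' b, f a b * g b := by
  simp only [PMF.bind_apply, ← ENNReal.tsum_mul_right, ← ENNReal.tsum_mul_left, mul_assoc]
  exact ENNReal.tsum_comm

theorem tsum_map_mul {α β : Type*} (p : PMF α) (f : α → β) (g : β → ENNReal) :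
    ∑' b, p.map f b * g b = ∑' a, p a * g (f a) := by
  rw [PMF.map, tsum_bind_mul]
  refine tsum_congr fun a => ?_
  rw [tsum_eq_single (f a)]
  · simp
  · intro b hb
    simp [hb]

theorem tsum_historyLaw_le (n : ℕ) :
    ∑' h, historyLaw work τ n h * ENNReal.ofReal (historyWeight work τ h) ≤
      ENNReal.ofReal (historyWeight work τ []) := by
  induction n with
  | zero =>
    rw [tsum_eq_single []]
    · simp [historyLaw]
    · intro h hh
      simp [historyLaw, hh]
  | succ n ih =>
    rw [historyLaw, tsum_bind_mul]
    refine le_trans (ENNReal.tsum_le_tsum fun h => ?_) ih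
    rw [tsum_map_mul]
    gcongr
    exact tsum_requestLaw_le work τ h

theorem toOuterMeasure_mul_le {α : Type*} (p : PMF α) (s : Set α) (a : ENNReal) (g : α → ENNReal)
    (hg : ∀ x ∈ s, a ≤ g x) : p.toOuterMeasure s * a ≤ ∑' x, p x * g x := by
  rw [PMF.toOuterMeasure_apply, ← ENNReal.tsum_mul_right]
  refine ENNReal.tsum_le_tsum fun x => ?_
  by_cases hx : x ∈ s
  · rw [Set.indicator_of_mem hx]
    gcongr
    exact hg x hx
  · simp [Set.indicator_of_notMem hx]

/-- By pigeonhole some processor makes more than `m` attempts, and its summand alone is large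
enough. -/
theorem rate_pow_le_historyWeight {m : ℕ} {h : List (Requests P)}
    (hm : P * m < stealAttempts h) : rate P ^ m ≤ historyWeight work τ h := by
  rw [stealAttempts_eq_sum] at hm
  obtain ⟨i, hi⟩ : ∃ i, m < attempts i h := by
    by_contra! hle
    have := Finset.sum_le_card_nsmul Finset.univ (fun i => attempts i h) m fun i _ => hle i
    simp at this
    omega
  calc rate P ^ m ≤ rate P ^ attempts i h := pow_le_pow_right₀ (one_le_rate P) hi.le
    _ ≤ rate P ^ attempts i h * (configAfter work τ h).weight i :=
        le_mul_of_one_le_right (pow_nonneg (rate_pos P).le _) (one_le_weight _ _)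
    _ ≤ _ := Finset.single_le_sum
        (f := fun i => rate P ^ attempts i h * (configAfter work τ h).weight i)
        (fun i _ => mul_nonneg (pow_nonneg (rate_pos P).le _)
          (zero_le_one.trans (one_le_weight _ _))) (Finset.mem_univ i)

theorem holdingPotential_initial_le (S : Finset (Fin P)) (p : Fin P) :
    holdingPotential S ((initial work).held p) ≤ 4 ^ span work := by
  unfold initial holdingPotential
  simp only
  cases hw : work p with
  | none => simp
  | some T =>
    simp only [Option.map_some, Option.elim_some]
    split_ifs
    · have h1 : T.height ≤ Finset.univ.sup fun i => (work i).elim 0 WorkTree.height := by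
        simpa [hw] using
          Finset.le_sup (f := fun i => (work i).elim 0 WorkTree.height) (Finset.mem_univ p)
      have h2 : T.maxTask ≤ Finset.univ.sup fun i => (work i).elim 0 WorkTree.maxTask := by
        simpa [hw] using
          Finset.le_sup (f := fun i => (work i).elim 0 WorkTree.maxTask) (Finset.mem_univ p)
      calc T.potential ≤ 4 ^ T.height * 4 ^ T.maxTask := by
            unfold WorkTree.potential
            gcongr
            norm_num
        _ = 4 ^ (T.height + T.maxTask) := (pow_add _ _ _).symm
        _ ≤ 4 ^ span work := pow_le_pow_right₀ (by norm_num) (by unfold span; omega)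
    · positivity

theorem potential_initial_le (S : Finset (Fin P)) :
    (initial work).potential S ≤ P * 4 ^ span work := by
  refine (Finset.sum_le_card_nsmul _ _ _ fun p _ =>
    holdingPotential_initial_le work S p).trans ?_
  simp

theorem historyWeight_nil_le (hP : 0 < P) :
    historyWeight work τ [] ≤ 8 * P ^ 3 * 16 ^ span work := by
  have hP' : (1 : ℝ) ≤ P := by exact_mod_cast hP
  have h4 : (1 : ℝ) ≤ 4 ^ span work := one_le_pow₀ (by norm_num)
  have h16 : (16 : ℝ) ^ span work = 4 ^ span work * 4 ^ span work := by
    rw [← mul_pow]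
    norm_num
  have hone : (1 : ℝ) ≤ P * 4 ^ span work := one_le_mul_of_one_le_of_one_le hP' h4
  have hw : ∀ i, (initial work).weight i ≤
      (2 * (P * 4 ^ span work)) * (2 * (P * 4 ^ span work)) * 2 := by
    intro i
    have h1 := potential_initial_le work Finset.univ
    have h2 := potential_initial_le work {i}
    have h3 := ((initial work).staleWeight_le i).trans (rate_pow_le_two hP)
    have h4 := (initial work).one_le_staleWeight i
    have h5 := (initial work).potential_nonneg {i}
    unfold weight
    gcongr <;> linarith
  calc historyWeight work τ [] = ∑ i, (initial work).weight i := by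
        simp [historyWeight, attempts, configAfter]
    _ ≤ P * ((2 * (P * 4 ^ span work)) * (2 * (P * 4 ^ span work)) * 2) := by
        refine (Finset.sum_le_card_nsmul _ _ _ fun i _ => hw i).trans ?_
        simp
    _ = _ := by
        rw [h16]
        ring

/-- Markov's inequality for the supermartingale. -/
theorem toOuterMeasure_lt_stealAttempts_le (hP : 0 < P) (n m : ℕ) :
    (historyLaw work τ n).toOuterMeasure {h | P * m < stealAttempts h} ≤
      ENNReal.ofReal (8 * P ^ 3 * 16 ^ span work / rate P ^ m) := by
  have hm : 0 < rate P ^ m := pow_pos (rate_pos P) m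
  rw [ENNReal.ofReal_div_of_pos hm, ENNReal.le_div_iff_mul_le
    (Or.inl (by simpa using hm)) (Or.inl ENNReal.ofReal_ne_top)]
  calc _ ≤ ∑' h, historyLaw work τ n h * ENNReal.ofReal (historyWeight work τ h) :=
        toOuterMeasure_mul_le _ _ _ _ fun h hh =>
          ENNReal.ofReal_le_ofReal (rate_pow_le_historyWeight work τ hh)
    _ ≤ ENNReal.ofReal (historyWeight work τ []) := tsum_historyLaw_le work τ n
    _ ≤ _ := ENNReal.ofReal_le_ofReal (historyWeight_nil_le work τ hP)

/-- A positive span is needed to absorb additive constants into the bound; with one processor and no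
work it is 0. -/
theorem one_le_span_of_two_le (hP : 2 ≤ P) : 1 ≤ span work := by
  have := Nat.clog_pos (b := 2) (n := P) (by norm_num) hP
  unfold span
  omega

/-- A single processor never attempts to steal. -/
theorem stealAttempts_eq_zero_of_mem_support (hP : P = 1) (n : ℕ) :
    ∀ h ∈ (historyLaw work τ n).support, stealAttempts h = 0 := by
  subst hP
  induction n with
  | zero =>
    intro h hh
    simp [historyLaw] at hh
    simp [hh, stealAttempts]
  | succ n ih =>
    intro h hh
    rw [historyLaw, PMF.mem_support_bind_iff] at hh
    obtain ⟨h', hh', hh⟩ := hh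
    rw [PMF.mem_support_map_iff] at hh
    obtain ⟨r, hr, rfl⟩ := hh
    have hr' : r ∈ Fintype.piFinset fun p => (configAfter work τ h').choices p := by
      simpa [requestLaw] using hr
    have hnone : ∀ p, r p = none := by
      intro p
      have hp := Fintype.mem_piFinset.mp hr' p
      by_cases hb : ((configAfter work τ h').held p).isSome = true
      · simpa [choices, hb] using hp
      · have : (configAfter work τ h').busy = ∅ := by
          refine Finset.filter_eq_empty_iff.mpr fun q _ => ?_
          rwa [Subsingleton.elim q p]
        simpa [choices, this] using hp
    have h0 := ih h' hh'
    rw [stealAttempts_eq_sum] at h0 ⊢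
    simpa [attempts, hnone] using h0

theorem ofReal_one_sub_le_of_compl {α : Type*} (p : PMF α) (s : Set α) {ε : ℝ} (hε : 0 ≤ ε)
    (h : p.toOuterMeasure sᶜ ≤ ENNReal.ofReal ε) :
    ENNReal.ofReal (1 - ε) ≤ p.toOuterMeasure s := by
  rw [ENNReal.ofReal_sub _ hε, ENNReal.ofReal_one, tsub_le_iff_right]
  have huniv : p.toOuterMeasure Set.univ = 1 :=
    (PMF.toOuterMeasure_apply_eq_one_iff _ _).mpr (Set.subset_univ _)
  calc 1 = p.toOuterMeasure (s ∪ sᶜ) := by rw [Set.union_compl_self, huniv]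
    _ ≤ p.toOuterMeasure s + p.toOuterMeasure sᶜ := MeasureTheory.measure_union_le _ _
    _ ≤ _ := by gcongr

theorem exists_attempts_bound (hP : 0 < P) {t : ℕ} (ht : 1 ≤ t) {ε : ℝ} (hε : 0 < ε)
    (hε1 : ε ≤ 1) :
    ∃ m : ℕ, 8 * (P : ℝ) ^ 3 * 16 ^ t / rate P ^ m ≤ ε ∧
      (P : ℝ) * m ≤ 32 * ((P : ℝ) ^ 2 * (t + Real.logb 2 (P / ε))) := by
  have hP' : (1 : ℝ) ≤ P := by exact_mod_cast hP
  have hP0 : (0 : ℝ) < P := by linarith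
  have ht' : (1 : ℝ) ≤ t := by exact_mod_cast ht
  have hq : 1 ≤ P / ε := by
    rw [one_le_div hε]
    linarith
  have hlog : 0 ≤ Real.logb 2 (P / ε) := Real.logb_nonneg (by norm_num) hq
  set L : ℝ := t + Real.logb 2 (P / ε) with hL
  -- Every `4 * P` factors of `rate P` give a factor 2. The exponent 7 comes from `8 ^ t * 16 ^ t =
  -- 2 ^ (7 * t)`, where `1 ≤ t` absorbs the constant 8. As `1 ≤ L`, the ceiling is at most `8 * L`,
  -- hence the constant `32 = 4 * 8`.
  refine ⟨4 * P * ⌈7 * L⌉₊, ?_, ?_⟩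
  · rw [div_le_iff₀ (pow_pos (rate_pos P) _), ← div_le_iff₀' hε]
    have h8 : (8 : ℝ) ≤ 8 ^ t := by simpa using pow_le_pow_right₀ (by norm_num : (1 : ℝ) ≤ 8) ht
    calc 8 * (P : ℝ) ^ 3 * 16 ^ t / ε ≤ 8 ^ t * (P / ε) ^ 3 * 16 ^ t := by
          rw [mul_right_comm, mul_div_assoc, mul_right_comm (8 ^ t : ℝ)]
          gcongr
          rw [div_pow]
          gcongr
          exact pow_le_of_le_one hε.le hε1 (by norm_num)
      _ = (2 ^ t) ^ 7 * (P / ε) ^ 3 := by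
          have : (8 : ℝ) ^ t * 16 ^ t = (2 ^ t) ^ 7 := by
            rw [← mul_pow, ← pow_mul, mul_comm t, pow_mul]
            norm_num
          rw [← this]
          ring
      _ ≤ (2 ^ t) ^ 7 * (P / ε) ^ 7 := by
          gcongr
          norm_num
      _ = 2 ^ (7 * L) := by
          rw [mul_comm 7 L, Real.rpow_mul (by norm_num), hL, Real.rpow_add (by norm_num),
            Real.rpow_natCast, Real.rpow_logb (by norm_num) (by norm_num) (by positivity),
            ← mul_pow]
          norm_cast
      _ ≤ 2 ^ (⌈7 * L⌉₊ : ℝ) :=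
          Real.rpow_le_rpow_of_exponent_le (by norm_num) (Nat.le_ceil _)
      _ = 2 ^ ⌈7 * L⌉₊ := Real.rpow_natCast _ _
      _ ≤ (rate P ^ (4 * P)) ^ ⌈7 * L⌉₊ :=
          pow_le_pow_left₀ (by norm_num) (two_le_rate_pow hP) _
      _ = rate P ^ (4 * P * ⌈7 * L⌉₊) := (pow_mul _ _ _).symm
  · have hceil := (Nat.ceil_lt_add_one (a := 7 * L) (by positivity)).le
    push_cast
    calc (P : ℝ) * (4 * P * ⌈7 * L⌉₊) = 4 * P ^ 2 * ⌈7 * L⌉₊ := by ring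
      _ ≤ 4 * P ^ 2 * (8 * L) := by
          gcongr
          linarith
      _ = _ := by ring

end Execution

end LocalizedStealing

theorem theorem3 :
    ∃ C : ℝ, 0 < C ∧
      ∀ (P : ℕ), 0 < P →
      ∀ (work : Fin P → Option LocalizedStealing.WorkTree)
        (τ : LocalizedStealing.TieBreak P) (ε : ℝ), 0 < ε → ε ≤ 1 →
      ∀ n : ℕ,
        ENNReal.ofReal (1 - ε) ≤
          (LocalizedStealing.historyLaw work τ n).toOuterMeasure
            {h | (LocalizedStealing.stealAttempts h : ℝ) ≤
              C * ((P : ℝ) ^ 2 *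
                ((LocalizedStealing.span work : ℝ) + Real.logb 2 ((P : ℝ) / ε)))} := by
  refine ⟨32, by norm_num, fun P hP work τ ε hε hε1 n => ?_⟩
  have hP' : (1 : ℝ) ≤ P := by exact_mod_cast hP
  refine LocalizedStealing.ofReal_one_sub_le_of_compl _ _ hε.le ?_
  rcases Nat.lt_or_ge 1 P with h2 | h1
  · obtain ⟨m, hm, hPm⟩ := LocalizedStealing.exists_attempts_bound hP
      (LocalizedStealing.one_le_span_of_two_le work h2) hε hε1
    refine le_trans (MeasureTheory.measure_mono fun h hh => ?_)
      ((LocalizedStealing.toOuterMeasure_lt_stealAttempts_le work τ hP n m).trans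
        (ENNReal.ofReal_le_ofReal hm))
    have hlt := hPm.trans_lt (not_le.mp hh)
    exact_mod_cast hlt
  -- For `P = 1` the bound can be 0 (no work, `ε = 1`), so it is essential that no attempt is ever
  -- made.
  · have hzero := LocalizedStealing.stealAttempts_eq_zero_of_mem_support work τ
      (le_antisymm h1 hP) n
    refine le_of_eq_of_le ((PMF.toOuterMeasure_apply_eq_zero_iff _ _).mpr ?_) bot_le
    refine Set.disjoint_left.mpr fun h hh hn => hn ?_
    have hlog : 0 ≤ Real.logb 2 (P / ε) := by
      refine Real.logb_nonneg (by norm_num) ?_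
      rw [one_le_div hε]
      linarith
    rw [Set.mem_ofPred_eq, hzero h hh, Nat.cast_zero]
    positivity
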